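/- Let $\gamma\ge 1$, and let $h(\rho)=\ln\rho$ if $\gamma=1$ and $h(\rho)=\frac{\gamma}{\gamma-1}\rho^{\gamma-1}$ if $\gamma>1$. Write $c_s(\rho)=\sqrt{\rho h'(\rho)}$ for the sound speed and $\lambda_1(\rho,u)=u-c_s(\rho)$, $\lambda_2(\rho,u)=u+c_s(\rho)$ for the characteristic speeds of the Euler system $$\rho_t+(\rho u)_x=0,\qquad u_t+\Big(\frac{u^2}{2}\Big)_x+h(\rho)_x=0 .$$ Let $\rho^\pm>0$ and let $u^\pm,s\in\mathbb R$ satisfy the Rankine–Hugoniot conditions $$s(\rho^+-\rho^-)=\rho^+u^+-\rho^-u^-,\qquad s(u^+-u^-)=\Big(\frac{(u^+)^2}{2}+h(\rho^+)\Big)-\Big(\frac{(u^-)^2}{2}+h(\rho^-)\Big).$$ Suppose that one of the following holds: (i) $(\rho^\pm,u^\pm;s)$ is a Lax 2-shock, $\lambda_2(\rho^+,u^+)<s<\lambda_2(\rho^-,u^-)$, with subsonic right state, $|u^+|<c_s(\rho^+)$; (ii) $(\rho^\pm,u^\pm;s)$ is a Lax 1-shock, $\lambda_1(\rho^+,u^+)<s<\lambda_1(\rho^-,u^-)$,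 with subsonic left state, $|u^-|<c_s(\rho^-)$. Then for all $\mu>0$ and $k>0$ there exists a traveling-wave profile with speed $s$ connecting $(\rho^-,u^-)$ to $(\rho^+,u^+)$ for the QHD system with nonlinear viscosity. That is, there are functions $P,U:\mathbb R\to\mathbb R$ with $P>0$ everywhere, $P(y)\to\sqrt{\rho^\pm}$, $P'(y)\to 0$ and $U(y)\to u^\pm$ as $y\to\pm\infty$, such that for every $\varepsilon>0$ the functions $$\rho(t,x)=P\Big(\frac{x-st}{\varepsilon}\Big)^2,\qquad u(t,x)=U\Big(\frac{x-st}{\varepsilon}\Big)$$ are of class $C^3$ and $C^2$, respectively, and solve, for all $(t,x)\in\mathbb R^2$, $$\rho_t+(\rho u)_x=0,\qquad u_t+\Big(\frac{u^2}{2}\Big)_x+h(\rho)_x=\varepsilon\mu\Big(\frac{(\rho u)_x}{\rho}\Big)_x+\varepsilon^2k^2\Big(\frac{(\sqrt\rho)_{xx}}{\sqrt\rho}\Big)_x .$$ -/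

import Mathlib

open Filter Topology

noncomputable section

namespace QHD

/-- The enthalpy of the pressure law `p(ρ) = ρ ^ γ`, `γ ≥ 1`. -/
def enthalpy (γ ρ : ℝ) : ℝ :=
  if γ = 1 then Real.log ρ else γ / (γ - 1) * ρ ^ (γ - 1)

/-- The sound speed `c_s(ρ) = √(ρ h'(ρ))`. -/
def soundSpeed (γ ρ : ℝ) : ℝ :=
  √(ρ * deriv (enthalpy γ) ρ)

/-- First characteristic speed of the Euler system
`ρ_t + (ρ u)_x = 0`, `u_t + (u² / 2)_x + h(ρ)_x = 0`. -/
def lambda₁ (γ ρ u : ℝ) : ℝ := u - soundSpeed γ ρ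

/-- Second characteristic speed of the same Euler system. -/
def lambda₂ (γ ρ u : ℝ) : ℝ := u + soundSpeed γ ρ

/-- The Rankine-Hugoniot conditions of that Euler system for the left state `(ρm, um)`, the right
state `(ρp, up)` and the speed `s`. -/
structure RankineHugoniot (γ ρm um ρp up s : ℝ) : Prop where
  mass : s * (ρp - ρm) = ρp * up - ρm * um
  velocity : s * (up - um) =
    (up ^ 2 / 2 + enthalpy γ ρp) - (um ^ 2 / 2 + enthalpy γ ρm)

/-- A Lax 1-shock: a Rankine-Hugoniot discontinuity with `λ₁(right) < s < λ₁(left)`. -/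
structure IsLaxOneShock (γ ρm um ρp up s : ℝ) : Prop where
  rankineHugoniot : RankineHugoniot γ ρm um ρp up s
  right_lt : lambda₁ γ ρp up < s
  lt_left : s < lambda₁ γ ρm um

/-- A Lax 2-shock: a Rankine-Hugoniot discontinuity with `λ₂(right) < s < λ₂(left)`. -/
structure IsLaxTwoShock (γ ρm um ρp up s : ℝ) : Prop where
  rankineHugoniot : RankineHugoniot γ ρm um ρp up s
  right_lt : lambda₂ γ ρp up < s
  lt_left : s < lambda₂ γ ρm um

/-- The state `(ρ, u)` is subsonic. -/
def IsSubsonic (γ ρ u : ℝ) : Prop := |u| < soundSpeed γ ρ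

/-- `(ρ, u)`, as functions of `(t, x)`, is a classical solution with positive density of the
quantum hydrodynamics system with nonlinear viscosity, in the variables density and velocity:
`ρ_t + (ρ u)_x = 0`,
`u_t + (u² / 2)_x + h(ρ)_x = ε μ ((ρ u)_x / ρ)_x + ε² k² ((√ρ)_xx / √ρ)_x`.
The regularity makes every derivative below exist in the classical sense. -/
structure IsQHDSolution (γ μ k ε : ℝ) (ρ u : ℝ → ℝ → ℝ) : Prop where
  density_pos : ∀ t x, 0 < ρ t x
  density_contDiff : ContDiff ℝ 3 (fun z : ℝ × ℝ => ρ z.1 z.2)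
  velocity_contDiff : ContDiff ℝ 2 (fun z : ℝ × ℝ => u z.1 z.2)
  mass : ∀ t x,
    deriv (fun t' => ρ t' x) t + deriv (fun x' => ρ t x' * u t x') x = 0
  velocity : ∀ t x,
    deriv (fun t' => u t' x) t + deriv (fun x' => u t x' ^ 2 / 2) x
        + deriv (fun x' => enthalpy γ (ρ t x')) x =
      ε * μ * deriv (fun x' => deriv (fun x'' => ρ t x'' * u t x'') x' / ρ t x') x
        + ε ^ 2 * k ^ 2 *
          deriv (fun x' => iteratedDeriv 2 (fun x'' => √(ρ t x'')) x' / √(ρ t x')) x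

/-- `(P, U)` is a traveling wave profile with speed `s` connecting `(ρm, um)` at `-∞` to `(ρp, up)`
at `+∞`: `P` is positive, for every `ε > 0` the functions `ρ(t, x) = P((x - s t) / ε)²` and
`u(t, x) = U((x - s t) / ε)` solve the QHD system, `(P, P')` is a heteroclinic connection from
`(√ρm, 0)` to `(√ρp, 0)`, and `U` has the limits `um` and `up`. -/
structure IsTravelingWaveProfile (γ μ k ρm um ρp up s : ℝ) (P U : ℝ → ℝ) : Prop where
  pos : ∀ y, 0 < P y
  isQHDSolution : ∀ ε : ℝ, 0 < ε →
    IsQHDSolution γ μ k ε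
      (fun t x => P ((x - s * t) / ε) ^ 2) (fun t x => U ((x - s * t) / ε))
  tendsto_P_atBot : Tendsto P atBot (𝓝 (√ρm))
  tendsto_P_atTop : Tendsto P atTop (𝓝 (√ρp))
  tendsto_P'_atBot : Tendsto (deriv P) atBot (𝓝 0)
  tendsto_P'_atTop : Tendsto (deriv P) atTop (𝓝 0)
  tendsto_U_atBot : Tendsto U atBot (𝓝 um)
  tendsto_U_atTop : Tendsto U atTop (𝓝 up)

end QHD

end

noncomputable section

namespace QHD

open Set

/-! In a traveling wave the mass equation says that A = (s - U) P² is constant, so U = s - A / P².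
The velocity equation can then be integrated once, and what remains is the amplitude equation k² P''
+ 2 μ s P' = P B(P²), where B(ρ) = A² / (2ρ²) + h(ρ) - C is the Bernoulli function in the frame of
the shock. The Rankine–Hugoniot conditions state that both end states have the same A and are zeros
of B for the same C.

For a 2-shock the subsonic right state gives s > u⁺ + c_s(ρ⁺) > 0, so this is Newton's equation with
positive friction. The Lax inequalities make the left state subsonic and the right state supersonic
relative to the shock. Since B decreases strictly while the relative flow is supersonic and
increases strictly once it is subsonic, √ρ⁻ is a saddle and √ρ⁺ is the only rest point below it
(`eq_of_bernoulli_eq_zero`).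

The orbit leaves the saddle downwards along its unstable manifold (`exists_unstable_orbit`).
Friction makes the energy P'² / 2 - G(P) fall below its value at the saddle, hence G(P) > G(√ρ⁻)
forever. As A ≠ 0, G tends to -∞ at the vacuum, so the orbit is trapped between a positive barrier
and √ρ⁻. Barbalat's lemma forces velocity and force to vanish at +∞, and the limit must be √ρ⁺
(`exists_heteroclinic_of_lipschitzWith`). A 1-shock has s < 0 and reduces to the same orbit by
reversing space. -/

/-! ### Global solutions of Lipschitz planar systems -/

theorem exists_clamp {B : ℝ} (hB : 0 ≤ B) :
    ∃ r : ℝ × ℝ → ℝ × ℝ, LipschitzWith 1 r ∧ (∀ x, ‖r x‖ ≤ B) ∧ (∀ x, ‖r x‖ ≤ ‖x‖) ∧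
      ∀ x, ‖x‖ ≤ B → r x = x := by
  have hc : ∀ y : ℝ, |max (-B) (min B y)| ≤ B := fun y => by
    rw [abs_le]; exact ⟨le_max_left _ _, max_le (by linarith) (min_le_left _ _)⟩
  have hc' : ∀ y : ℝ, |max (-B) (min B y)| ≤ |y| := fun y => by
    rw [abs_le]
    constructor
    · rcases le_total B y with h | h
      · rw [min_eq_left h, max_eq_right (by linarith)]; linarith [abs_nonneg y]
      · rw [min_eq_right h]; exact (neg_abs_le y).trans (le_max_right _ _)
    · rcases le_total (-B) (min B y) with h | h
      · rw [max_eq_right h]; exact (min_le_right _ _).trans (le_abs_self y)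
      · rw [max_eq_left h]; linarith [abs_nonneg y]
  have hl : LipschitzWith 1 (fun y : ℝ => max (-B) (min B y)) :=
    (LipschitzWith.id.const_min B).const_max (-B)
  refine ⟨fun x => (max (-B) (min B x.1), max (-B) (min B x.2)), ?_, ?_, ?_, ?_⟩
  · have h := (hl.comp LipschitzWith.prod_fst).prodMk (hl.comp LipschitzWith.prod_snd)
    simpa using h
  · intro x
    exact max_le (hc _) (hc _)
  · intro x
    exact max_le_max (hc' _) (hc' _)
  · rintro ⟨x, y⟩ h
    have h1 := abs_le.1 ((le_max_left _ _).trans h : |x| ≤ B)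
    have h2 := abs_le.1 ((le_max_right _ _).trans h : |y| ≤ B)
    ext
    · simp [h1.1, h1.2]
    · simp [h2.1, h2.2]

/-- Truncating the field by the clamp makes it bounded, so Picard–Lindelöf applies on an interval of
any length. The clamp does not increase norms, hence the truncated field keeps linear growth, and
Gronwall bounds its solution by the truncation radius B: the truncation was never active. -/
theorem exists_solution_Icc {K : NNReal} {V : ℝ × ℝ → ℝ × ℝ} (hV : LipschitzWith K V)
    (x₀ : ℝ × ℝ) {T : ℝ} (hT : 0 ≤ T) :
    ∃ x : ℝ → ℝ × ℝ, x 0 = x₀ ∧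
      ∀ t ∈ Icc (-T) T, HasDerivWithinAt x (V (x t)) (Icc (-T) T) t := by
  have hgr : ∀ t ∈ Icc 0 T, gronwallBound ‖x₀‖ K ‖V 0‖ t ≤ gronwallBound ‖x₀‖ K ‖V 0‖ T :=
    fun t ht => gronwallBound_mono (norm_nonneg _) (norm_nonneg _) K.2 ht.2
  set B := gronwallBound ‖x₀‖ K ‖V 0‖ T with hBdef
  have hB : 0 ≤ B := by
    have := hgr 0 ⟨le_rfl, hT⟩
    rw [gronwallBound_x0] at this
    exact (norm_nonneg _).trans this
  obtain ⟨r, hr1, hrB, hrn, hrid⟩ := exists_clamp hB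
  have hVr : LipschitzWith K (V ∘ r) := by simpa using hV.comp hr1
  have hVn : ∀ x, ‖V x‖ ≤ K * ‖x‖ + ‖V 0‖ := fun x => by
    have h1 := hV.norm_sub_le x 0
    have h2 := norm_sub_norm_le (V x) (V 0)
    simp only [sub_zero] at h1
    linarith
  have hVb : ∀ x, ‖(V ∘ r) x‖ ≤ K * B + ‖V 0‖ := fun x =>
    (hVn _).trans (by have := mul_le_mul_of_nonneg_left (hrB x) K.2; simpa using this)
  have hM : 0 ≤ K * B + ‖V 0‖ := (norm_nonneg _).trans (hVb 0)
  have hPL : IsPicardLindelof (fun _ => V ∘ r) (⟨0, by simpa using hT⟩ : Icc (-T) T) x₀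
      (⟨(K * B + ‖V 0‖) * T, mul_nonneg hM hT⟩) 0 ⟨K * B + ‖V 0‖, hM⟩ K := by
    apply IsPicardLindelof.of_time_independent
    · intro x _; exact hVb x
    · exact hVr.lipschitzOnWith
    · simp only [sub_zero, sub_neg_eq_add, zero_add, max_self, NNReal.coe_zero]
      exact le_rfl
  obtain ⟨x, hx0, hx⟩ := hPL.exists_eq_forall_mem_Icc_hasDerivWithinAt₀
  simp only at hx0
  have hbd : ∀ t ∈ Icc (-T) T, ‖x t‖ ≤ B := by
    have hcont : ContinuousOn x (Icc (-T) T) := fun t ht => (hx t ht).continuousWithinAt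
    have key : ∀ t ∈ Icc 0 T, ‖x t‖ ≤ B := by
      intro t ht
      refine le_trans ?_ (hgr t ht)
      have := norm_le_gronwallBound_of_norm_deriv_right_le (f := x) (f' := fun t => (V ∘ r) (x t))
        (δ := ‖x₀‖) (K := K) (ε := ‖V 0‖) (a := 0) (b := T)
        (hcont.mono (Icc_subset_Icc (by linarith) le_rfl)) ?_ (by rw [hx0]) ?_ t ht
      · simpa using this
      · intro s hs
        exact ((hx s ⟨by linarith [hs.1], hs.2.le⟩).hasDerivAt
          (Icc_mem_nhds (by linarith [hs.1, hs.2]) hs.2)).hasDerivWithinAt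
      · intro s _
        exact (hVn _).trans (by gcongr; exact hrn _)
    have key' : ∀ t ∈ Icc 0 T, ‖x (-t)‖ ≤ B := by
      intro t ht
      refine le_trans ?_ (hgr t ht)
      have := norm_le_gronwallBound_of_norm_deriv_right_le (f := fun t => x (-t))
        (f' := fun t => -(V ∘ r) (x (-t)))
        (δ := ‖x₀‖) (K := K) (ε := ‖V 0‖) (a := 0) (b := T) ?_ ?_ (by simp [hx0]) ?_ t ht
      · simpa using this
      · refine hcont.comp continuous_neg.continuousOn fun s hs => ?_
        exact ⟨by linarith [hs.2], by linarith [hs.1, hs.2]⟩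
      · intro s hs
        have h := (hx (-s) ⟨by linarith [hs.2], by linarith [hs.1, hs.2]⟩).hasDerivAt
          (Icc_mem_nhds (by linarith [hs.2]) (by linarith [hs.1, hs.2]))
        have h2 := h.scomp s (hasDerivAt_neg s)
        simpa [Function.comp_def] using h2.hasDerivWithinAt
      · intro s _
        rw [norm_neg]
        exact (hVn _).trans (by gcongr; exact hrn _)
    intro t ht
    rcases le_total 0 t with h | h
    · exact key t ⟨h, ht.2⟩
    · simpa using key' (-t) ⟨by linarith, by linarith [ht.1]⟩
  refine ⟨x, hx0, fun t ht => ?_⟩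
  have := hx t ht
  simpa [hrid _ (hbd t ht)] using this

theorem exists_global_solution {K : NNReal} {V : ℝ × ℝ → ℝ × ℝ} (hV : LipschitzWith K V)
    (x₀ : ℝ × ℝ) : ∃ x : ℝ → ℝ × ℝ, x 0 = x₀ ∧ ∀ t, HasDerivAt x (V (x t)) t := by
  choose y hy0 hy using fun n : ℕ =>
    exists_solution_Icc hV x₀ (T := (n : ℝ) + 1) (by positivity)
  have hyd : ∀ n : ℕ, ∀ t ∈ Ioo (-((n : ℝ) + 1)) (n + 1), HasDerivAt (y n) (V (y n t)) t :=
    fun n t ht => (hy n t ⟨ht.1.le, ht.2.le⟩).hasDerivAt (Icc_mem_nhds ht.1 ht.2)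
  have huniq : ∀ n m : ℕ, n ≤ m → ∀ t ∈ Ioo (-((n : ℝ) + 1)) (n + 1), y n t = y m t := by
    intro n m hnm t ht
    have hnm' : (n : ℝ) ≤ m := by exact_mod_cast hnm
    refine ODE_solution_unique_of_mem_Ioo (v := fun _ => V) (s := fun _ => univ) (K := K)
      (t₀ := 0) (fun _ _ => hV.lipschitzOnWith) ⟨?_, ?_⟩
      (fun s hs => ⟨hyd n s hs, mem_univ _⟩)
      (fun s hs => ⟨hyd m s ⟨by linarith [hs.1], by linarith [hs.2]⟩, mem_univ _⟩)
      (by rw [hy0, hy0]) ht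
    · linarith [Nat.cast_nonneg (α := ℝ) n]
    · positivity
  refine ⟨fun t => y ⌈|t|⌉₊ t, by simp [hy0], fun t => ?_⟩
  -- The index of the glued solution jumps at integers; this larger one serves for every s with |s|
  -- < |t| + 1.
  set N := ⌈|t|⌉₊ + 1 with hN
  have hmem : ∀ s : ℝ, s ∈ Ioo (-((⌈|s|⌉₊ : ℝ) + 1)) (⌈|s|⌉₊ + 1) := fun s => by
    have := Nat.le_ceil |s|
    have h2 := abs_le.1 this
    exact ⟨by linarith [h2.1], by linarith [h2.2]⟩
  have hev : (fun s => y ⌈|s|⌉₊ s) =ᶠ[𝓝 t] y N := by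
    have : ∀ᶠ s in 𝓝 t, |s| < |t| + 1 := (continuous_abs.tendsto t).eventually
      (gt_mem_nhds (by linarith))
    filter_upwards [this] with s hs
    refine huniq _ _ ?_ s (hmem s)
    rw [hN]
    refine Nat.ceil_le.2 ?_
    push_cast
    linarith [Nat.le_ceil |t|]
  have h := hyd N t (by
    have := hmem t
    rw [hN]; push_cast
    exact ⟨by linarith [this.1], by linarith [this.2]⟩)
  have he : y ⌈|t|⌉₊ t = y N t := hev.eq_of_nhds
  simp only [he]
  exact h.congr_of_eventuallyEq hev

theorem dist_solution_neg_le {K : NNReal} {V : ℝ × ℝ → ℝ × ℝ} (hV : LipschitzWith K V)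
    {x y : ℝ → ℝ × ℝ} (hx : ∀ t, HasDerivAt x (V (x t)) t) (hy : ∀ t, HasDerivAt y (V (y t)) t)
    {t : ℝ} (ht : 0 ≤ t) : dist (x (-t)) (y (-t)) ≤ dist (x 0) (y 0) * Real.exp (K * t) := by
  have hrev : ∀ x : ℝ → ℝ × ℝ, (∀ t, HasDerivAt x (V (x t)) t) →
      ∀ t, HasDerivAt (fun s => x (-s)) (-V (x (-t))) t := fun x hx t => by
    have h2 := (hx (-t)).scomp t (hasDerivAt_neg t)
    simpa [Function.comp_def] using h2
  have hcont : ∀ x : ℝ → ℝ × ℝ, (∀ t, HasDerivAt x (V (x t)) t) →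
      Continuous fun s => x (-s) := fun x hx =>
    continuous_iff_continuousAt.2 fun t => (hrev x hx t).continuousAt
  have := dist_le_of_trajectories_ODE (v := fun _ z => -V z) (K := K) (a := 0) (b := t)
    (f := fun s => x (-s)) (g := fun s => y (-s)) (δ := dist (x 0) (y 0))
    (fun _ => hV.neg) (hcont x hx).continuousOn
    (fun s _ => (hrev x hx s).hasDerivWithinAt) (hcont y hy).continuousOn
    (fun s _ => (hrev y hy s).hasDerivWithinAt) (by simp) t ⟨ht, le_rfl⟩
  simpa using this

/-! ### Unstable manifold of the saddle -/

theorem nonneg_of_neg_mul_le_deriv {u d : ℝ → ℝ} {c T : ℝ} (hu : ∀ t, HasDerivAt u (d t) t)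
    (h : ∀ t ∈ Icc 0 T, -c * u t ≤ d t) (h0 : 0 ≤ u 0) : ∀ t ∈ Icc 0 T, 0 ≤ u t := by
  have hv : ∀ t, HasDerivAt (fun s => Real.exp (c * s) * u s)
      (Real.exp (c * t) * (d t + c * u t)) t := fun t => by
    have h1 : HasDerivAt (fun s => Real.exp (c * s)) (Real.exp (c * t) * (c * 1)) t :=
      ((hasDerivAt_id t).const_mul c).exp
    convert! h1.mul (hu t) using 1
    ring
  have hmono : MonotoneOn (fun s => Real.exp (c * s) * u s) (Icc 0 T) := by
    refine monotoneOn_of_deriv_nonneg (convex_Icc 0 T)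
      (fun t _ => (hv t).continuousAt.continuousWithinAt)
      (fun t _ => (hv t).differentiableAt.differentiableWithinAt) fun t ht => ?_
    rw [(hv t).deriv]
    have := h t (interior_subset ht)
    exact mul_nonneg (Real.exp_pos _).le (by linarith)
  intro t ht
  have := hmono ⟨le_rfl, ht.1.trans ht.2⟩ ht ht.1
  simp only [mul_zero, Real.exp_zero, one_mul] at this
  exact nonneg_of_mul_nonneg_right (h0.trans this) (Real.exp_pos _)

/-- Along the flow, (w - m z)' = g(z) - (a + m) m z - (a + m) (w - m z). The bounds on g are exactly
the sign conditions that keep an orbit above the ray w = m₁ z and below the ray w = m₂ z; inside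
this cone z grows at a rate between m₁ and m₂. -/
theorem cone_invariant {a m₁ m₂ δ ε T : ℝ} (hm : m₁ ≤ m₂)
    (hε : 0 < ε) {g z w : ℝ → ℝ} (hlow : ∀ z ≤ δ, (a + m₁) * m₁ * z ≤ g z)
    (hup : ∀ z ∈ Icc 0 δ, g z ≤ (a + m₂) * m₂ * z)
    (hz : ∀ t, HasDerivAt z (w t) t) (hw : ∀ t, HasDerivAt w (g (z t) - a * w t) t)
    (hz0 : z 0 = ε) (hw0 : w 0 = m₁ * ε) (hzδ : ∀ t ∈ Icc 0 T, z t ≤ δ) :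
    ∀ t ∈ Icc 0 T, ε * Real.exp (m₁ * t) ≤ z t ∧ z t ≤ ε * Real.exp (m₂ * t) ∧
      m₁ * z t ≤ w t ∧ w t ≤ m₂ * z t := by
  have hexp : ∀ m t : ℝ, HasDerivAt (fun s => ε * Real.exp (m * s))
      (ε * (Real.exp (m * t) * (m * 1))) t := fun m t =>
    (((hasDerivAt_id t).const_mul m).exp).const_mul ε
  have h1 : ∀ t ∈ Icc 0 T, 0 ≤ w t - m₁ * z t := by
    refine nonneg_of_neg_mul_le_deriv (c := a + m₁)
      (fun t => (hw t).sub ((hz t).const_mul m₁)) (fun t ht => ?_) (by simp [hz0, hw0])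
    have := hlow _ (hzδ t ht)
    linarith
  have h2 : ∀ t ∈ Icc 0 T, 0 ≤ z t - ε * Real.exp (m₁ * t) := by
    refine nonneg_of_neg_mul_le_deriv (c := -m₁)
      (fun t => (hz t).sub (hexp m₁ t)) (fun t ht => ?_) (by simp [hz0])
    have := h1 t ht
    linarith
  have hpos : ∀ t ∈ Icc 0 T, 0 ≤ z t := fun t ht => by
    have := h2 t ht
    have : 0 < ε * Real.exp (m₁ * t) := by positivity
    linarith
  have h3 : ∀ t ∈ Icc 0 T, 0 ≤ m₂ * z t - w t := by
    refine nonneg_of_neg_mul_le_deriv (c := a + m₂)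
      (fun t => ((hz t).const_mul m₂).sub (hw t)) (fun t ht => ?_) ?_
    · have := hup _ ⟨hpos t ht, hzδ t ht⟩
      linarith
    · rw [hz0, hw0]
      nlinarith
  have h4 : ∀ t ∈ Icc 0 T, 0 ≤ ε * Real.exp (m₂ * t) - z t := by
    refine nonneg_of_neg_mul_le_deriv (c := -m₂)
      (fun t => (hexp m₂ t).sub (hz t)) (fun t ht => ?_) (by simp [hz0])
    have := h3 t ht
    linarith
  intro t ht
  exact ⟨by linarith [h2 t ht], by linarith [h4 t ht], by linarith [h1 t ht],
    by linarith [h3 t ht]⟩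

/-- The phase-plane vector field of `z'' + a z' = g(z)`. -/
def dampedField (a : ℝ) (g : ℝ → ℝ) (x : ℝ × ℝ) : ℝ × ℝ := (x.2, g x.1 - a * x.2)

theorem exists_lipschitzWith_dampedField (a : ℝ) {g : ℝ → ℝ} {K : NNReal}
    (hg : LipschitzWith K g) : ∃ K', LipschitzWith K' (dampedField a g) :=
  ⟨_, LipschitzWith.prod_snd.prodMk
    ((hg.comp LipschitzWith.prod_fst).sub ((lipschitzWith_smul a).comp LipschitzWith.prod_snd))⟩

theorem dampedField_solution {a : ℝ} {g : ℝ → ℝ} {x : ℝ → ℝ × ℝ}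
    (hx : ∀ t, HasDerivAt x (dampedField a g (x t)) t) :
    (∀ t, HasDerivAt (fun s => (x s).1) (x t).2 t) ∧
      ∀ t, HasDerivAt (fun s => (x s).2) (g (x t).1 - a * (x t).2) t :=
  ⟨fun t => (hx t).fst, fun t => (hx t).snd⟩

/-- The closed sector in which the local unstable manifold of the saddle is sought. -/
def sector (m₁ m₂ δ : ℝ) : Set (ℝ × ℝ) :=
  {x | 0 ≤ x.1 ∧ x.1 ≤ δ ∧ m₁ * x.1 ≤ x.2 ∧ x.2 ≤ m₂ * x.1}

theorem isClosed_sector (m₁ m₂ δ : ℝ) : IsClosed (sector m₁ m₂ δ) :=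
  (isClosed_le continuous_const continuous_fst).inter
    ((isClosed_le continuous_fst continuous_const).inter
      ((isClosed_le (by fun_prop) continuous_snd).inter
        (isClosed_le continuous_snd (by fun_prop))))

theorem exists_orbit_in_sector {a m₁ m₂ δ : ℝ} (hm₁ : 0 < m₁) (hm : m₁ ≤ m₂)
    (hδ : 0 < δ) {g : ℝ → ℝ} {K : NNReal} (hV : LipschitzWith K (dampedField a g))
    (hlow : ∀ z ≤ δ, (a + m₁) * m₁ * z ≤ g z)
    (hup : ∀ z ∈ Icc 0 δ, g z ≤ (a + m₂) * m₂ * z) {N : ℝ} (hN : 0 ≤ N) :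
    ∃ x : ℝ → ℝ × ℝ, (∀ t, HasDerivAt x (dampedField a g (x t)) t) ∧ (x 0).1 = δ ∧
      ∀ t ∈ Icc 0 N, x (-t) ∈ sector m₁ m₂ δ := by
  have hm₂ : 0 < m₂ := hm₁.trans_le hm
  -- Growth at rate at most m₂ from this height needs at least time N to reach δ. The start lies on
  -- the lower edge of the sector, and growth at rate at least m₁ ensures that δ is reached.
  set ε := δ * Real.exp (-(m₂ * N)) with hεdef
  have hε : 0 < ε := by positivity
  have hεδ : ε ≤ δ := by
    have : Real.exp (-(m₂ * N)) ≤ 1 := Real.exp_le_one_iff.2 (by nlinarith)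
    nlinarith
  obtain ⟨x, hx0, hx⟩ := exists_global_solution hV (ε, m₁ * ε)
  obtain ⟨hz, hw⟩ := dampedField_solution hx
  have hcone := fun T (h : ∀ t ∈ Icc 0 T, (x t).1 ≤ δ) =>
    cone_invariant hm hε hlow hup hz hw (by rw [hx0]) (by rw [hx0]) h
  have hcont : Continuous fun t => (x t).1 := continuous_iff_continuousAt.2
    fun t => (hz t).continuousAt
  set S := {t : ℝ | 0 ≤ t ∧ δ ≤ (x t).1} with hS
  have hSne : S.Nonempty := by
    by_contra hne
    have hlt : ∀ t, 0 ≤ t → (x t).1 < δ := fun t ht => by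
      by_contra hcon
      exact hne ⟨t, ht, not_lt.1 hcon⟩
    obtain ⟨t, ht⟩ : ∃ t : ℝ, 0 ≤ t ∧ δ ≤ ε * (m₁ * t) :=
      ⟨δ / (ε * m₁), by positivity, by field_simp; exact le_rfl⟩
    have h1 := (hcone t (fun s hs => (hlt s hs.1).le) t ⟨ht.1, le_rfl⟩).1
    have h2 := Real.add_one_le_exp (m₁ * t)
    have h3 := hlt t ht.1
    nlinarith
  have hScl : IsClosed S :=
    (isClosed_le continuous_const continuous_id).inter (isClosed_le continuous_const hcont)
  have hSbd : BddBelow S := ⟨0, fun t ht => ht.1⟩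
  set T := sInf S with hT
  have hTS : T ∈ S := hScl.csInf_mem hSne hSbd
  have hbefore : ∀ t ∈ Ico 0 T, (x t).1 < δ := fun t ht => by
    by_contra hcon
    exact absurd (csInf_le hSbd (⟨ht.1, not_lt.1 hcon⟩ : t ∈ S)) (not_le.2 ht.2)
  have hTδ : (x T).1 = δ := by
    refine le_antisymm ?_ hTS.2
    rcases hTS.1.eq_or_lt with h | h
    · rw [← h, hx0]; exact hεδ
    · have hcl : T ∈ closure (Ico 0 T) := by
        rw [closure_Ico h.ne]; exact ⟨h.le, le_rfl⟩
      exact closure_minimal (fun t ht => (hbefore t ht).le)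
        (isClosed_le hcont continuous_const) hcl
  have hle : ∀ t ∈ Icc 0 T, (x t).1 ≤ δ := fun t ht => by
    rcases ht.2.eq_or_lt with h | h
    · rw [h, hTδ]
    · exact (hbefore t ⟨ht.1, h⟩).le
  have hNT : N ≤ T := by
    have h := (hcone T hle T ⟨hTS.1, le_rfl⟩).2.1
    rw [hTδ, hεdef, mul_assoc, ← Real.exp_add] at h
    have h1 : 1 ≤ Real.exp (-(m₂ * N) + m₂ * T) := by
      by_contra hcon
      nlinarith [not_le.1 hcon]
    have h2 := Real.one_le_exp_iff.1 h1
    nlinarith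
  -- Time is shifted so that the first arrival at height δ happens at time 0.
  refine ⟨fun t => x (t + T), fun t => (hx (t + T)).comp_add_const t T, by simpa using hTδ, ?_⟩
  intro t ht
  have hmem : -t + T ∈ Icc 0 T := ⟨by linarith [ht.2], by linarith [ht.1]⟩
  have h := hcone T hle _ hmem
  exact ⟨(by positivity : 0 ≤ ε * Real.exp (m₁ * (-t + T))).trans h.1, hle _ hmem, h.2.2⟩

/-- Shooting and compactness: among the orbits through (δ, v), those staying in the sector during
the backward time n form nonempty nested compact sets of velocities v. A common point gives an orbit
that stays in the sector for all negative time. -/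
theorem exists_unstable_orbit {a m₁ m₂ δ : ℝ} (hm₁ : 0 < m₁) (hm : m₁ ≤ m₂)
    (hδ : 0 < δ) {g : ℝ → ℝ} {K : NNReal} (hg : LipschitzWith K g)
    (hlow : ∀ z ≤ δ, (a + m₁) * m₁ * z ≤ g z)
    (hup : ∀ z ∈ Icc 0 δ, g z ≤ (a + m₂) * m₂ * z) :
    ∃ z w : ℝ → ℝ, (∀ t, HasDerivAt z (w t) t) ∧ (∀ t, HasDerivAt w (g (z t) - a * w t) t) ∧
      z 0 = δ ∧ ∀ t ≤ 0, 0 ≤ z t ∧ z t ≤ δ ∧ m₁ * z t ≤ w t ∧ w t ≤ m₂ * z t := by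
  obtain ⟨K', hV⟩ := exists_lipschitzWith_dampedField a hg
  choose φ hφ0 hφ using fun v : ℝ => exists_global_solution hV (δ, v)
  have hcont : ∀ t, 0 ≤ t → Continuous fun v => φ v (-t) := fun t ht => by
    refine (LipschitzWith.of_dist_le_mul (K := (Real.exp (K' * t)).toNNReal) fun v v' => ?_).continuous
    have h := dist_solution_neg_le hV (hφ v) (hφ v') ht
    rw [hφ0, hφ0, dist_prod_same_left, mul_comm] at h
    rwa [Real.coe_toNNReal _ (Real.exp_pos _).le]
  set S : ℕ → Set ℝ := fun n =>
    Icc (m₁ * δ) (m₂ * δ) ∩ {v | ∀ t ∈ Icc (0 : ℝ) n, φ v (-t) ∈ sector m₁ m₂ δ} with hS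
  have hclosed : ∀ n, IsClosed (S n) := fun n => by
    refine isClosed_Icc.inter ?_
    have : {v | ∀ t ∈ Icc (0 : ℝ) n, φ v (-t) ∈ sector m₁ m₂ δ} =
        ⋂ t ∈ Icc (0 : ℝ) n, (fun v => φ v (-t)) ⁻¹' sector m₁ m₂ δ := by
      ext v; simp
    rw [this]
    exact isClosed_biInter fun t ht => (isClosed_sector m₁ m₂ δ).preimage (hcont t ht.1)
  have hne : ∀ n, (S n).Nonempty := fun n => by
    obtain ⟨x, hx, hxδ, hsec⟩ := exists_orbit_in_sector hm₁ hm hδ hV hlow hup n.cast_nonneg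
    have hx0 : x 0 ∈ sector m₁ m₂ δ := by simpa using hsec 0 ⟨le_rfl, n.cast_nonneg⟩
    have heq : φ (x 0).2 = x := ODE_solution_unique_univ (v := fun _ => dampedField a g)
      (s := fun _ => univ) (K := K') (t₀ := 0) (fun _ => hV.lipschitzOnWith)
      (fun t => ⟨hφ _ t, mem_univ _⟩) (fun t => ⟨hx t, mem_univ _⟩)
      (by rw [hφ0, ← hxδ])
    refine ⟨(x 0).2, ⟨?_, ?_⟩, fun t ht => ?_⟩
    · rw [← hxδ]; exact hx0.2.2.1
    · rw [← hxδ]; exact hx0.2.2.2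
    · rw [heq]; exact hsec t ht
  obtain ⟨v, hv⟩ := IsCompact.nonempty_iInter_of_sequence_nonempty_isCompact_isClosed S
    (fun n v hv => ⟨hv.1, fun t ht => hv.2 t ⟨ht.1, ht.2.trans (by push_cast; linarith)⟩⟩) hne
    (isCompact_Icc.of_isClosed_subset (hclosed 0) inter_subset_left) hclosed
  obtain ⟨hz, hw⟩ := dampedField_solution (hφ v)
  refine ⟨_, _, hz, hw, by simp [hφ0], fun t ht => ?_⟩
  obtain ⟨n, hn⟩ := exists_nat_ge (-t)
  have h := (mem_iInter.1 hv n).2 (-t) ⟨by linarith, hn⟩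
  rwa [neg_neg] at h

/-! ### Asymptotic behaviour of orbits -/

theorem lipschitzWith_of_abs_deriv_le {u d : ℝ → ℝ} {C : ℝ} (hu : ∀ t, HasDerivAt u (d t) t)
    (hC : ∀ t, |d t| ≤ C) : LipschitzWith C.toNNReal u := by
  refine lipschitzWith_of_nnnorm_deriv_le (fun t => (hu t).differentiableAt) fun t => ?_
  rw [(hu t).deriv, ← NNReal.coe_le_coe]
  simpa using Or.inl (hC t)

/-- **Barbalat's lemma**. -/
theorem tendsto_deriv_zero_of_lipschitzWith {y d : ℝ → ℝ} {l : ℝ} {K : NNReal}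
    (hy : ∀ t, HasDerivAt y (d t) t) (hl : Tendsto y atTop (𝓝 l)) (hd : LipschitzWith K d) :
    Tendsto d atTop (𝓝 0) := by
  rw [Metric.tendsto_atTop]
  intro ε hε
  have hK : (0 : ℝ) ≤ K := K.2
  -- Over a step of this length d varies by less than ε / 2, while the mean slope of y tends to 0.
  set h := ε / (2 * (K + 1)) with hh
  have hh0 : 0 < h := by positivity
  have hKh : K * h < ε / 2 := by
    rw [hh, mul_div_assoc', div_lt_div_iff₀ (by positivity) (by positivity)]
    nlinarith
  have hsub : Tendsto (fun t => (y (t + h) - y t) / h) atTop (𝓝 0) := by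
    have := ((hl.comp (tendsto_atTop_add_const_right atTop h tendsto_id)).sub hl).div_const h
    simpa using this
  obtain ⟨N, hN⟩ := Metric.tendsto_atTop.1 hsub (ε / 2) (by positivity)
  refine ⟨N, fun t ht => ?_⟩
  obtain ⟨ξ, hξ, he⟩ := exists_hasDerivAt_eq_slope y d (show t < t + h by linarith)
    (fun s _ => (hy s).continuousAt.continuousWithinAt) (fun s _ => hy s)
  have h1 := hN t ht
  rw [add_sub_cancel_left] at he
  rw [← he, Real.dist_eq, sub_zero] at h1
  have h2 := hd.dist_le_mul t ξ
  have h3 : dist t ξ ≤ h := by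
    rw [Real.dist_eq, abs_sub_comm, abs_of_pos (by linarith [hξ.1])]
    linarith [hξ.2]
  have h4 : (K : ℝ) * dist t ξ ≤ K * h := mul_le_mul_of_nonneg_left h3 hK
  rw [Real.dist_eq] at h2 ⊢
  have h5 := abs_add_le (d t - d ξ) (d ξ)
  rw [sub_add_cancel] at h5
  rw [sub_zero]
  linarith

theorem exp_bounds_of_sector {m₁ m₂ δ : ℝ} {z w : ℝ → ℝ} (hz : ∀ t, HasDerivAt z (w t) t)
    (hz0 : z 0 = δ) (h : ∀ t ≤ 0, m₁ * z t ≤ w t ∧ w t ≤ m₂ * z t) :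
    ∀ t ≤ 0, δ * Real.exp (m₂ * t) ≤ z t ∧ z t ≤ δ * Real.exp (m₁ * t) := by
  have hrev : ∀ s, HasDerivAt (fun s => z (-s)) (-w (-s)) s := fun s => by
    have h2 := (hz (-s)).scomp s (hasDerivAt_neg s)
    simpa [Function.comp_def] using h2
  have hexp : ∀ m s : ℝ, HasDerivAt (fun s => δ * Real.exp (-m * s))
      (δ * (Real.exp (-m * s) * (-m * 1))) s := fun m s =>
    (((hasDerivAt_id s).const_mul (-m)).exp).const_mul δ
  intro t ht
  have hmem : -t ∈ Icc 0 (-t) := ⟨by linarith, le_rfl⟩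
  constructor
  · have := nonneg_of_neg_mul_le_deriv (c := m₂) (fun s => (hrev s).sub (hexp m₂ s))
      (fun s hs => by have := (h (-s) (by linarith [hs.1])).2; simp only [Pi.sub_apply]; linarith)
      (by simp [hz0]) (-t) hmem
    simpa using this
  · have := nonneg_of_neg_mul_le_deriv (c := m₁) (fun s => (hexp m₁ s).sub (hrev s))
      (fun s hs => by have := (h (-s) (by linarith [hs.1])).1; simp only [Pi.sub_apply]; linarith)
      (by simp [hz0]) (-t) hmem
    simpa using this

theorem energy_hasDerivAt {a : ℝ} {f G P Q : ℝ → ℝ} {t : ℝ} (hG : HasDerivAt G (f (P t)) (P t))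
    (hP : HasDerivAt P (Q t) t) (hQ : HasDerivAt Q (f (P t) - a * Q t) t) :
    HasDerivAt (fun s => Q s ^ 2 / 2 - G (P s)) (-a * Q t ^ 2) t := by
  convert! ((hQ.pow 2).div_const 2).sub (hG.comp t hP) using 1
  simp only [Nat.cast_ofNat, Nat.add_one_sub_one, pow_one]
  ring

/-- Barbalat's lemma is used twice: on the decreasing energy, whose derivative is -a Q², and then on
Q, whose derivative f(P) - a Q must also tend to 0. -/
theorem tendsto_rest_point {a m q : ℝ} (ha : 0 < a) {f G P Q : ℝ → ℝ} {K : NNReal}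
    (hf : LipschitzWith K f) (hG : ∀ x, HasDerivAt G (f x) x)
    (hP : ∀ t, HasDerivAt P (Q t) t) (hQ : ∀ t, HasDerivAt Q (f (P t) - a * Q t) t)
    (hmem : ∀ t, P t ∈ Icc m q) {E : ℝ} (hE : ∀ t, Q t ^ 2 / 2 - G (P t) ≤ E) :
    Tendsto Q atTop (𝓝 0) ∧ Tendsto (fun t => f (P t)) atTop (𝓝 0) := by
  have hGc : Continuous G := continuous_iff_continuousAt.2 fun x => (hG x).continuousAt
  obtain ⟨M, hM⟩ := isCompact_Icc.exists_bound_of_continuousOn (s := Icc m q) hGc.continuousOn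
  obtain ⟨M', hM'⟩ := isCompact_Icc.exists_bound_of_continuousOn (s := Icc m q)
    hf.continuous.continuousOn
  simp only [Real.norm_eq_abs] at hM hM'
  have hEd := fun t => energy_hasDerivAt (hG (P t)) (hP t) (hQ t)
  have hanti : Antitone fun s => Q s ^ 2 / 2 - G (P s) := by
    refine antitone_of_deriv_nonpos (fun t => (hEd t).differentiableAt) fun t => ?_
    rw [(hEd t).deriv]
    nlinarith [sq_nonneg (Q t)]
  have hlim := tendsto_atTop_ciInf hanti ⟨-M, by
    rintro _ ⟨t, rfl⟩
    have := (abs_le.1 (hM _ (hmem t))).2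
    simp only
    nlinarith [sq_nonneg (Q t)]⟩
  -- Follows from |Q| ≤ 1 + Q² and Q² ≤ 2 (E + M).
  have hQb : ∀ t, |Q t| ≤ 1 + 2 * (E + M) := fun t => by
    have h1 := (abs_le.1 (hM _ (hmem t))).2
    have h2 := hE t
    rw [abs_le]
    constructor <;> nlinarith [sq_nonneg (Q t - 1), sq_nonneg (Q t + 1)]
  set B := 1 + 2 * (E + M)
  have hB : 0 ≤ B := (abs_nonneg _).trans (hQb 0)
  have hQ'b : ∀ t, |f (P t) - a * Q t| ≤ M' + a * B := fun t => by
    refine (abs_sub _ _).trans ?_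
    rw [abs_mul, abs_of_pos ha]
    exact add_le_add (hM' _ (hmem t)) (mul_le_mul_of_nonneg_left (hQb t) ha.le)
  have hQ2 : ∀ t, HasDerivAt (fun s => -a * Q s ^ 2)
      (-a * (2 * Q t * (f (P t) - a * Q t))) t := fun t => by
    simpa using ((hQ t).pow 2).const_mul (-a)
  have hlip := lipschitzWith_of_abs_deriv_le (C := a * (2 * B * (M' + a * B))) hQ2 fun t => by
    rw [abs_mul, abs_neg, abs_of_pos ha, abs_mul, abs_mul, abs_two]
    gcongr
    · exact hQb t
    · exact hQ'b t
  have hQ20 := tendsto_deriv_zero_of_lipschitzWith hEd hlim hlip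
  have hQ0 : Tendsto Q atTop (𝓝 0) := by
    have h1 : Tendsto (fun t => Q t ^ 2) atTop (𝓝 0) := by
      have := hQ20.const_mul (-a)⁻¹
      simpa [ha.ne'] using this
    rw [tendsto_zero_iff_abs_tendsto_zero]
    simpa [Function.comp_def, Real.sqrt_sq_eq_abs] using h1.sqrt
  refine ⟨hQ0, ?_⟩
  have hPlip := lipschitzWith_of_abs_deriv_le hP hQb
  have hQlip := lipschitzWith_of_abs_deriv_le hQ hQ'b
  have h1 := tendsto_deriv_zero_of_lipschitzWith hQ hQ0
    ((hf.comp hPlip).sub ((lipschitzWith_smul a).comp hQlip))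
  simpa using h1.add (hQ0.const_mul a)

/-- By continuity every cluster point of P in the compact set is a zero of f, hence equals p. -/
theorem tendsto_of_unique_zero {f P : ℝ → ℝ} {S : Set ℝ} {p : ℝ} (hS : IsCompact S)
    (hf : Continuous f) (hP : ∀ᶠ t in atTop, P t ∈ S)
    (hlim : Tendsto (fun t => f (P t)) atTop (𝓝 0)) (huniq : ∀ x ∈ S, f x = 0 → x = p) :
    Tendsto P atTop (𝓝 p) := by
  refine hS.tendsto_nhds_of_unique_mapClusterPt hP fun x hx hc => huniq x hx ?_
  have h1 : MapClusterPt (f x) atTop (f ∘ P) := hc.continuousAt_comp hf.continuousAt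
  have h2 : ClusterPt (f x) (𝓝 0) := ClusterPt.mono h1 hlim
  exact eq_of_nhds_neBot h2

/-! ### Heteroclinic orbits of the damped equation -/

theorem exists_heteroclinic_of_lipschitzWith {a b δ m p q : ℝ} (ha : 0 < a) (hb : 0 < b)
    (hδ : 0 < δ) (hmδ : m < q - δ) {f G : ℝ → ℝ} {K : NNReal} (hf : LipschitzWith K f)
    (hfq : ∀ x, q ≤ x → f x = 0) (hlow : ∀ x ∈ Icc (q - δ) q, f x ≤ -b * (q - x))
    (huniq : ∀ x ∈ Ico m q, f x = 0 → x = p)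
    (hG : ∀ x, HasDerivAt G (f x) x) (hGm : G m < G q) :
    ∃ P Q : ℝ → ℝ, (∀ t, HasDerivAt P (Q t) t) ∧ (∀ t, HasDerivAt Q (f (P t) - a * Q t) t) ∧
      (∀ t, P t ∈ Ioo m q) ∧ Tendsto P atBot (𝓝 q) ∧ Tendsto P atTop (𝓝 p) ∧
      Tendsto Q atBot (𝓝 0) ∧ Tendsto Q atTop (𝓝 0) := by
  -- With m₁ ≤ 1 this gives (a + m₁) m₁ ≤ (a + 1) m₁ ≤ b, the condition for the lower ray; m₂ = 1 +
  -- K gives the one for the upper ray. The saddle is moved to the origin by z = q - P.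
  set m₁ := min 1 (b / (a + 1)) with hm₁def
  have hm₁ : 0 < m₁ := lt_min one_pos (by positivity)
  have hm₁b : (a + m₁) * m₁ ≤ b := by
    have h1 : m₁ ≤ 1 := min_le_left _ _
    have h2 : m₁ ≤ b / (a + 1) := min_le_right _ _
    rw [le_div_iff₀ (by positivity)] at h2
    nlinarith
  set m₂ : ℝ := 1 + K with hm₂def
  have hK0 : (0 : ℝ) ≤ K := K.2
  have hm12 : m₁ ≤ m₂ := (min_le_left _ _).trans (by linarith)
  have hm₂b : (K : ℝ) ≤ (a + m₂) * m₂ := by nlinarith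
  have hglip : LipschitzWith K fun z => -f (q - z) := by
    have h : LipschitzWith 1 fun z : ℝ => q - z := by
      simpa using (LipschitzWith.const q).sub LipschitzWith.id
    have h2 := (hf.comp h).neg
    rw [mul_one] at h2
    exact h2
  obtain ⟨z, w, hz, hw, hz0, hsec⟩ := exists_unstable_orbit (a := a) hm₁ hm12 hδ hglip
    (fun z hz => by
      rcases le_total z 0 with h | h
      · rw [hfq _ (by linarith), neg_zero]
        exact mul_nonpos_of_nonneg_of_nonpos (by positivity) h
      · have := hlow (q - z) ⟨by linarith, by linarith⟩
        nlinarith)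
    (fun z hz => by
      have h := hf.dist_le_mul (q - z) q
      rw [hfq q le_rfl, Real.dist_eq, Real.dist_eq, sub_zero] at h
      have h2 : |q - z - q| = z := by
        rw [show q - z - q = -z by ring, abs_neg, abs_of_nonneg hz.1]
      rw [h2] at h
      have := neg_le_abs (f (q - z))
      nlinarith [hz.1])
  have hexp := exp_bounds_of_sector hz hz0 fun t ht => (hsec t ht).2.2
  have hzlim : Tendsto z atBot (𝓝 0) := by
    have h1 : Tendsto (fun t => δ * Real.exp (m₁ * t)) atBot (𝓝 0) := by
      have := (Real.tendsto_exp_atBot.comp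
        (tendsto_id.const_mul_atBot hm₁)).const_mul δ
      simpa [Function.comp_def] using this
    refine tendsto_of_tendsto_of_tendsto_of_le_of_le' tendsto_const_nhds h1 ?_ ?_
    · filter_upwards [eventually_le_atBot 0] with t ht using (hsec t ht).1
    · filter_upwards [eventually_le_atBot 0] with t ht using (hexp t ht).2
  have hwlim : Tendsto w atBot (𝓝 0) := by
    have h1 := hzlim.const_mul m₁
    have h2 := hzlim.const_mul m₂
    rw [mul_zero] at h1 h2
    refine tendsto_of_tendsto_of_tendsto_of_le_of_le' h1 h2 ?_ ?_
    · filter_upwards [eventually_le_atBot 0] with t ht using (hsec t ht).2.2.1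
    · filter_upwards [eventually_le_atBot 0] with t ht using (hsec t ht).2.2.2
  have hwpos : ∀ t ≤ 0, 0 < w t := fun t ht => by
    have h1 := (hexp t ht).1
    have h2 : 0 < δ * Real.exp (m₂ * t) := by positivity
    exact (mul_pos hm₁ (h2.trans_le h1)).trans_le (hsec t ht).2.2.1
  have hP : ∀ t, HasDerivAt (fun s => q - z s) (-w t) t := fun t => (hz t).const_sub q
  have hQ : ∀ t, HasDerivAt (fun s => -w s) (f (q - z t) - a * (-w t)) t := fun t => by
    convert! (hw t).neg using 1
    ring
  have hPbot : Tendsto (fun s => q - z s) atBot (𝓝 q) := by simpa using hzlim.const_sub q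
  have hQbot : Tendsto (fun s => -w s) atBot (𝓝 0) := by simpa using hwlim.neg
  have hPc : Continuous fun s => q - z s :=
    continuous_iff_continuousAt.2 fun t => (hP t).continuousAt
  have hGc : Continuous G := continuous_iff_continuousAt.2 fun x => (hG x).continuousAt
  have hEd := fun t => energy_hasDerivAt (P := fun s => q - z s) (Q := fun s => -w s) (hG _)
    (hP t) (hQ t)
  set E := fun s => (-w s) ^ 2 / 2 - G (q - z s) with hEdef
  have hanti : Antitone E := by
    refine antitone_of_deriv_nonpos (fun t => (hEd t).differentiableAt) fun t => ?_
    rw [(hEd t).deriv]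
    nlinarith [sq_nonneg (w t)]
  have hEbot : Tendsto E atBot (𝓝 (-G q)) := by
    have := ((hQbot.pow 2).div_const 2).sub ((hGc.tendsto q).comp hPbot)
    simpa [hEdef] using this
  -- Strictness comes from the initial stretch t ≤ 0, where w > 0 and friction dissipates a positive
  -- amount over a unit of time.
  have hElt : ∀ t, E t < -G q := fun t => by
    set s := min t 0 with hs
    have hs0 : s ≤ 0 := min_le_right _ _
    obtain ⟨ξ, hξ, he⟩ := exists_hasDerivAt_eq_slope E _ (show s - 1 < s by linarith)
      (fun r _ => (hEd r).continuousAt.continuousWithinAt) (fun r _ => hEd r)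
    have h1 := hwpos ξ (by linarith [hξ.2])
    rw [sub_sub_cancel, div_one] at he
    have h2 : E (s - 1) ≤ -G q := hanti.ge_of_tendsto hEbot (s - 1)
    have h3 : E t ≤ E s := hanti (min_le_left _ _)
    have h4 : 0 < a * (-w ξ) ^ 2 := by
      have : (-w ξ) ≠ 0 := by linarith
      positivity
    linarith
  have hGlt : ∀ t, G q < G (q - z t) := fun t => by
    have := hElt t
    simp only [hEdef] at this
    nlinarith [sq_nonneg (w t)]
  -- Crossing m or q would force equality there at some time, but G(P) > G(q) excludes both points.
  have hmem : ∀ t, q - z t ∈ Ioo m q := fun t => by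
    constructor
    · by_contra hcon
      obtain ⟨s, hs⟩ := mem_range_of_exists_le_of_exists_ge hPc ⟨t, not_lt.1 hcon⟩
        ⟨0, by rw [hz0]; exact hmδ.le⟩
      have := hGlt s
      simp only at hs
      rw [hs] at this
      linarith
    · by_contra hcon
      obtain ⟨s, hs⟩ := mem_range_of_exists_le_of_exists_ge hPc
        ⟨0, by rw [hz0]; linarith⟩ ⟨t, not_lt.1 hcon⟩
      have := hGlt s
      simp only at hs
      rw [hs] at this
      exact lt_irrefl _ this
  obtain ⟨hQtop, hftop⟩ := tendsto_rest_point ha hf hG hP hQ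
    (fun t => Ioo_subset_Icc_self (hmem t)) fun t => (hElt t).le
  refine ⟨_, _, hP, hQ, hmem, hPbot, ?_, hQbot, hQtop⟩
  -- Since -E(0) > G(q), the superlevel set excludes the zero q of f and leaves p as the only
  -- candidate.
  refine tendsto_of_unique_zero (S := Icc m q ∩ {x | -E 0 ≤ G x})
    (isCompact_Icc.inter_right (isClosed_le continuous_const hGc)) hf.continuous ?_ hftop ?_
  · filter_upwards [eventually_ge_atTop 0] with t ht
    refine ⟨Ioo_subset_Icc_self (hmem t), ?_⟩
    have := hanti ht
    simp only [hEdef] at this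
    change -E 0 ≤ G (q - z t)
    simp only [hEdef]
    nlinarith [sq_nonneg (w t)]
  · rintro x ⟨hx, hxE⟩ hfx
    refine huniq x ⟨hx.1, lt_of_le_of_ne hx.2 ?_⟩ hfx
    rintro rfl
    have := hElt 0
    change -E 0 ≤ G x at hxE
    linarith

/-- The force is made globally Lipschitz by constant extension outside [m, q], which is harmless
because the orbit stays inside. Differentiability at q supplies the one-sided linear bound near the
saddle, with b / 2 in place of b. -/
theorem exists_heteroclinic {a b m p q : ℝ} (ha : 0 < a) (hb : 0 < b) (hmq : m < q)
    {f F : ℝ → ℝ} {K : NNReal} (hf : LipschitzOnWith K f (Icc m q))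
    (hfq : f q = 0) (hfb : HasDerivAt f b q)
    (huniq : ∀ x ∈ Ico m q, f x = 0 → x = p)
    (hF : ∀ x ∈ Icc m q, HasDerivAt F (f x) x) (hFm : F m < F q) :
    ∃ P Q : ℝ → ℝ, (∀ t, HasDerivAt P (Q t) t) ∧ (∀ t, HasDerivAt Q (f (P t) - a * Q t) t) ∧
      (∀ t, P t ∈ Ioo m q) ∧ Tendsto P atBot (𝓝 q) ∧ Tendsto P atTop (𝓝 p) ∧
      Tendsto Q atBot (𝓝 0) ∧ Tendsto Q atTop (𝓝 0) := by
  set g : ℝ → ℝ := IccExtend hmq.le ((Icc m q).domRestrict f) with hg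
  have hgf : ∀ x ∈ Icc m q, g x = f x := fun x hx => by
    rw [hg, IccExtend_of_mem _ _ hx]; rfl
  have hglip : LipschitzWith K g := by
    have h := (lipschitzOnWith_iff_restrict.1 hf).comp (LipschitzWith.projIcc hmq.le)
    rw [mul_one] at h
    exact h
  have hgq : ∀ x, q ≤ x → g x = 0 := fun x hx => by
    rw [hg, IccExtend_of_right_le _ _ hx]; exact hfq
  have hG : ∀ x, HasDerivAt (fun y => ∫ s in q..y, g s) (g x) x := fun x =>
    intervalIntegral.integral_hasDerivAt_right (hglip.continuous.intervalIntegrable _ _)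
      (hglip.continuous.stronglyMeasurableAtFilter _ _) hglip.continuous.continuousAt
  have hGm : (∫ s in q..m, g s) < ∫ s in q..q, g s := by
    rw [intervalIntegral.integral_same, intervalIntegral.integral_congr (g := f) fun x hx =>
      hgf x (by rwa [uIcc_of_ge hmq.le] at hx),
      intervalIntegral.integral_eq_sub_of_hasDerivAt (f := F) (fun x hx =>
        hF x (by rwa [uIcc_of_ge hmq.le] at hx))]
    · linarith
    · exact (hf.continuousOn.mono (by rw [uIcc_of_ge hmq.le])).intervalIntegrable
  obtain ⟨η, hη, hηf⟩ : ∃ η > 0, ∀ x, |x - q| < η → |f x - b * (x - q)| ≤ b / 2 * |x - q| := by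
    have := (hasDerivAt_iff_isLittleO.1 hfb).def (show 0 < b / 2 by positivity)
    obtain ⟨η, hη, h⟩ := Metric.eventually_nhds_iff.1 this
    refine ⟨η, hη, fun x hx => ?_⟩
    have := h (y := x) (by rwa [Real.dist_eq])
    simpa [hfq, mul_comm b] using this
  set δ := min (η / 2) ((q - m) / 2) with hδ
  have hδ0 : 0 < δ := lt_min (by positivity) (by linarith)
  have hδη : δ ≤ η / 2 := min_le_left _ _
  have hδm : δ ≤ (q - m) / 2 := min_le_right _ _
  obtain ⟨P, Q, hP, hQ, hmem, h⟩ := exists_heteroclinic_of_lipschitzWith (p := p) ha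
    (show 0 < b / 2 by positivity) hδ0 (show m < q - δ by linarith) hglip hgq
    (fun x hx => by
      rw [hgf x ⟨by linarith [hx.1], hx.2⟩]
      have h0 : |x - q| = q - x := by rw [abs_sub_comm, abs_of_nonneg (by linarith [hx.2])]
      have h1 := hηf x (by rw [h0]; linarith [hx.1])
      rw [h0] at h1
      linarith [(abs_le.1 h1).2])
    (fun x hx h0 => huniq x hx (by rwa [hgf x (Ico_subset_Icc_self hx)] at h0)) hG hGm
  refine ⟨P, Q, hP, fun t => ?_, hmem, h⟩
  have := hQ t
  rwa [hgf _ (Ioo_subset_Icc_self (hmem t))] at this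

/-! ### Enthalpy and the Bernoulli function -/

theorem hasDerivAt_enthalpy {γ ρ : ℝ} (hρ : 0 < ρ) :
    HasDerivAt (enthalpy γ) (γ * ρ ^ (γ - 2)) ρ := by
  by_cases h : γ = 1
  · have he : enthalpy γ = Real.log := by funext x; simp [enthalpy, h]
    rw [he]
    convert! Real.hasDerivAt_log hρ.ne' using 1
    rw [h, show (1 : ℝ) - 2 = -1 by norm_num, Real.rpow_neg_one, one_mul]
  · have he : enthalpy γ = fun x => γ / (γ - 1) * x ^ (γ - 1) := by
      funext x; simp [enthalpy, h]
    rw [he]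
    have h1 : γ - 1 ≠ 0 := sub_ne_zero.2 h
    convert! (Real.hasDerivAt_rpow_const (p := γ - 1) (Or.inl hρ.ne')).const_mul (γ / (γ - 1))
      using 1
    rw [← mul_assoc, div_mul_cancel₀ _ h1]
    congr 2
    ring

theorem contDiffOn_enthalpy (γ : ℝ) (n : WithTop ℕ∞) :
    ContDiffOn ℝ n (enthalpy γ) (Ioi 0) := by
  intro x hx
  have hx0 : x ≠ 0 := (ne_of_gt hx)
  refine ContDiffAt.contDiffWithinAt ?_
  by_cases h : γ = 1
  · have he : enthalpy γ = Real.log := by funext x; simp [enthalpy, h]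
    rw [he]
    exact Real.contDiffAt_log.2 hx0
  · have he : enthalpy γ = fun x => γ / (γ - 1) * x ^ (γ - 1) := by
      funext x; simp [enthalpy, h]
    rw [he]
    exact contDiffAt_const.mul (Real.contDiffAt_rpow_const_of_ne hx0)

theorem soundSpeed_eq {γ ρ : ℝ} (hρ : 0 < ρ) : soundSpeed γ ρ = √(γ * ρ ^ (γ - 1)) := by
  rw [soundSpeed, (hasDerivAt_enthalpy hρ).deriv]
  congr 1
  rw [show γ - 1 = 1 + (γ - 2) by ring, Real.rpow_add hρ, Real.rpow_one]
  ring

/-- The primitive of the enthalpy. -/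
def enthalpyPrimitive (γ ρ : ℝ) : ℝ :=
  if γ = 1 then ρ * Real.log ρ - ρ else ρ ^ γ / (γ - 1)

theorem hasDerivAt_enthalpyPrimitive {γ ρ : ℝ} (hρ : 0 < ρ) :
    HasDerivAt (enthalpyPrimitive γ) (enthalpy γ ρ) ρ := by
  by_cases h : γ = 1
  · have he : enthalpyPrimitive γ = fun x => x * Real.log x - x := by
      funext x; simp [enthalpyPrimitive, h]
    rw [he]
    convert! (Real.hasDerivAt_mul_log hρ.ne').sub (hasDerivAt_id ρ) using 1
    simp [enthalpy, h]
  · have he : enthalpyPrimitive γ = fun x => x ^ γ / (γ - 1) := by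
      funext x; simp [enthalpyPrimitive, h]
    rw [he]
    convert! (Real.hasDerivAt_rpow_const (p := γ) (Or.inl hρ.ne')).div_const (γ - 1) using 1
    simp only [enthalpy, h, if_false]
    ring

theorem enthalpyPrimitive_le {γ ρ : ℝ} (hγ : 1 ≤ γ) (hρ : 0 < ρ) (hρ1 : ρ ≤ 1) :
    enthalpyPrimitive γ ρ ≤ 1 / (γ - 1) := by
  by_cases h : γ = 1
  · have hl := Real.log_nonpos hρ.le hρ1
    -- For γ = 1 the bound 1 / (γ - 1) is 0 by convention, and ρ log ρ - ρ ≤ 0 on (0, 1].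
    simp only [enthalpyPrimitive, h, if_true, sub_self, div_zero]
    nlinarith
  · have h1 : 0 < γ - 1 := sub_pos.2 (lt_of_le_of_ne hγ (Ne.symm h))
    simp only [enthalpyPrimitive, h, if_false]
    gcongr
    exact Real.rpow_le_one hρ.le hρ1 (by linarith)

/-- The Bernoulli function `A² / (2 ρ²) + h(ρ) - C` of the steady Euler flow with mass flux `A`. -/
def bernoulli (γ A C ρ : ℝ) : ℝ := A ^ 2 / (2 * ρ ^ 2) + enthalpy γ ρ - C

theorem hasDerivAt_bernoulli {γ A C ρ : ℝ} (hρ : 0 < ρ) :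
    HasDerivAt (bernoulli γ A C) (γ * ρ ^ (γ - 2) - A ^ 2 / ρ ^ 3) ρ := by
  have h1 : HasDerivAt (fun x : ℝ => A ^ 2 / (2 * x ^ 2)) (-A ^ 2 / ρ ^ 3) ρ := by
    convert! (((hasDerivAt_id ρ).pow 2).const_mul 2).inv
      (show 2 * id ρ ^ 2 ≠ 0 by simp [hρ.ne']) |>.const_mul (A ^ 2) using 1
    simp only [id, Pi.pow_apply, Nat.cast_ofNat, Nat.add_one_sub_one, pow_one, mul_one]
    field_simp
  convert! (h1.add (hasDerivAt_enthalpy (γ := γ) hρ)).sub_const C using 1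
  ring

/-- For A = v ρ the numerator is ρ² (c_s² - v²), so the sign tells whether the relative flow is
subsonic or supersonic. -/
theorem bernoulli_deriv_eq {γ A ρ : ℝ} (hρ : 0 < ρ) :
    γ * ρ ^ (γ - 2) - A ^ 2 / ρ ^ 3 = (γ * ρ ^ (γ + 1) - A ^ 2) / ρ ^ 3 := by
  have h : ρ ^ (γ + 1) = ρ ^ (γ - 2) * ρ ^ 3 := by
    rw [← Real.rpow_natCast, ← Real.rpow_add hρ]
    congr 1
    push_cast
    ring
  rw [h]
  field_simp

theorem contDiffOn_bernoulli (γ A C : ℝ) (n : WithTop ℕ∞) :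
    ContDiffOn ℝ n (bernoulli γ A C) (Ioi 0) := by
  have h : ContDiffOn ℝ n (fun x : ℝ => A ^ 2 / (2 * x ^ 2)) (Ioi 0) :=
    contDiffOn_const.div (by fun_prop) fun x hx => by
      have : (0 : ℝ) < x := hx
      positivity
  exact (h.add (contDiffOn_enthalpy γ n)).sub contDiffOn_const

theorem bernoulli_lt_of_supersonic {γ A C x y : ℝ} (hγ : 1 ≤ γ) (hx : 0 < x) (hxy : x < y)
    (h : γ * y ^ (γ + 1) ≤ A ^ 2) : bernoulli γ A C y < bernoulli γ A C x := by
  refine strictAntiOn_of_deriv_neg (convex_Icc x y) (fun z hz =>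
    (hasDerivAt_bernoulli (hx.trans_le hz.1)).continuousAt.continuousWithinAt) (fun z hz => ?_)
    ⟨le_rfl, hxy.le⟩ ⟨hxy.le, le_rfl⟩ hxy
  rw [interior_Icc] at hz
  have hz0 := hx.trans hz.1
  rw [(hasDerivAt_bernoulli hz0).deriv, bernoulli_deriv_eq hz0]
  refine div_neg_of_neg_of_pos ?_ (by positivity)
  have := Real.rpow_lt_rpow hz0.le hz.2 (show 0 < γ + 1 by linarith)
  nlinarith

theorem bernoulli_lt_of_subsonic {γ A C x y : ℝ} (hγ : 1 ≤ γ) (hx : 0 < x) (hxy : x < y)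
    (h : A ^ 2 ≤ γ * x ^ (γ + 1)) : bernoulli γ A C x < bernoulli γ A C y := by
  refine strictMonoOn_of_deriv_pos (convex_Icc x y) (fun z hz =>
    (hasDerivAt_bernoulli (hx.trans_le hz.1)).continuousAt.continuousWithinAt) (fun z hz => ?_)
    ⟨le_rfl, hxy.le⟩ ⟨hxy.le, le_rfl⟩ hxy
  rw [interior_Icc] at hz
  have hz0 := hx.trans hz.1
  rw [(hasDerivAt_bernoulli hz0).deriv, bernoulli_deriv_eq hz0]
  refine div_pos ?_ (by positivity)
  have := Real.rpow_lt_rpow hx.le hz.1 (show 0 < γ + 1 by linarith)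
  nlinarith

theorem eq_of_bernoulli_eq_zero {γ A C ρ₁ ρ₂ x : ℝ} (hγ : 1 ≤ γ) (hρ₁ : 0 < ρ₁)
    (h1 : bernoulli γ A C ρ₁ = 0) (h2 : bernoulli γ A C ρ₂ = 0)
    (hsup : γ * ρ₁ ^ (γ + 1) < A ^ 2) (hx : 0 < x) (hx2 : x < ρ₂)
    (h : bernoulli γ A C x = 0) : x = ρ₁ := by
  rcases lt_trichotomy x ρ₁ with hlt | heq | hgt
  · have := bernoulli_lt_of_supersonic (C := C) hγ hx hlt hsup.le
    linarith
  · exact heq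
  · rcases le_total (γ * x ^ (γ + 1)) (A ^ 2) with hc | hc
    · have := bernoulli_lt_of_supersonic (C := C) hγ hρ₁ hgt hc
      linarith
    · have := bernoulli_lt_of_subsonic (C := C) hγ hx hx2 hc
      linarith

/-- The primitive of the Bernoulli function. -/
def bernoulliPrimitive (γ A C ρ : ℝ) : ℝ := -(A ^ 2 / 2 * ρ⁻¹) + enthalpyPrimitive γ ρ - C * ρ

theorem hasDerivAt_bernoulliPrimitive {γ A C ρ : ℝ} (hρ : 0 < ρ) :
    HasDerivAt (bernoulliPrimitive γ A C) (bernoulli γ A C ρ) ρ := by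
  convert! ((((hasDerivAt_inv hρ.ne').const_mul (A ^ 2 / 2)).neg).add
    (hasDerivAt_enthalpyPrimitive (γ := γ) hρ)).sub ((hasDerivAt_id ρ).const_mul C) using 1
  rw [bernoulli]
  field_simp

/-- Near the vacuum the kinetic term -A² / (2ρ) dominates; this yields the barrier that keeps the
density positive. -/
theorem exists_bernoulliPrimitive_lt {γ A C ρ : ℝ} (hγ : 1 ≤ γ) (hA : A ≠ 0) (hρ : 0 < ρ)
    (B : ℝ) : ∃ x, 0 < x ∧ x < ρ ∧ bernoulliPrimitive γ A C x < B := by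
  have hlim : Tendsto (fun x : ℝ => A ^ 2 / 2 * x⁻¹) (𝓝[>] 0) atTop :=
    tendsto_inv_nhdsGT_zero.const_mul_atTop (by positivity)
  have h1 : ∀ᶠ x : ℝ in 𝓝[>] 0, x ∈ Ioo 0 (min 1 ρ) :=
    Ioo_mem_nhdsGT (lt_min one_pos hρ)
  obtain ⟨x, hx, hxB⟩ := (h1.and
    (hlim.eventually (eventually_gt_atTop (1 / (γ - 1) + |C| - B)))).exists
  have hx1 : x < 1 := hx.2.trans_le (min_le_left _ _)
  refine ⟨x, hx.1, hx.2.trans_le (min_le_right _ _), ?_⟩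
  have h2 := enthalpyPrimitive_le hγ hx.1 hx1.le
  have h3 : -(C * x) ≤ |C| := by
    have := neg_le_abs (C * x)
    rw [abs_mul, abs_of_pos hx.1] at this
    nlinarith [abs_nonneg C]
  rw [bernoulliPrimitive]
  linarith

/-! ### Orbits of the amplitude equation and their regularity -/

theorem exists_amplitude_orbit {γ A C a c ρ₁ ρ₂ : ℝ} (hγ : 1 ≤ γ) (ha : 0 < a) (hc : 0 < c)
    (hρ₁ : 0 < ρ₁) (hρ₂ : 0 < ρ₂)
    (h1 : bernoulli γ A C ρ₁ = 0) (h2 : bernoulli γ A C ρ₂ = 0)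
    (hsup : γ * ρ₁ ^ (γ + 1) < A ^ 2) (hsub : A ^ 2 < γ * ρ₂ ^ (γ + 1)) :
    ∃ P Q : ℝ → ℝ, (∀ t, HasDerivAt P (Q t) t) ∧
      (∀ t, HasDerivAt Q (c * (P t * bernoulli γ A C (P t ^ 2)) - a * Q t) t) ∧
      (∀ t, 0 < P t) ∧ Tendsto P atBot (𝓝 (√ρ₂)) ∧ Tendsto P atTop (𝓝 (√ρ₁)) ∧
      Tendsto Q atBot (𝓝 0) ∧ Tendsto Q atTop (𝓝 0) := by
  have hA : A ≠ 0 := by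
    rintro rfl
    have : 0 < γ * ρ₁ ^ (γ + 1) := by positivity
    norm_num at hsup
    linarith
  have hq : 0 < √ρ₂ := Real.sqrt_pos.2 hρ₂
  have hq2 : √ρ₂ ^ 2 = ρ₂ := Real.sq_sqrt hρ₂.le
  obtain ⟨r, hr0, hr, hrlt⟩ := exists_bernoulliPrimitive_lt (C := C) hγ hA hρ₂
    (bernoulliPrimitive γ A C ρ₂)
  have hm0 : 0 < √r := Real.sqrt_pos.2 hr0
  have hf : ContDiffOn ℝ 1 (fun x : ℝ => c * (x * bernoulli γ A C (x ^ 2))) (Ioi 0) := by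
    refine contDiffOn_const.mul (contDiffOn_id.mul
      ((contDiffOn_bernoulli γ A C 1).comp (contDiffOn_id.pow 2) fun x hx => ?_))
    exact pow_pos (mem_Ioi.1 hx) 2
  have hsubset : Icc (√r) (√ρ₂) ⊆ Ioi 0 := fun x hx => hm0.trans_le hx.1
  have hlip : ∃ K, LipschitzOnWith K (fun x : ℝ => c * (x * bernoulli γ A C (x ^ 2)))
      (Icc (√r) (√ρ₂)) := (hf.mono hsubset).exists_lipschitzOnWith one_ne_zero
        (convex_Icc _ _) isCompact_Icc
  obtain ⟨K, hK⟩ := hlip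
  have hsq : ∀ x : ℝ, HasDerivAt (fun x : ℝ => x ^ 2) (2 * x) x := fun x => by
    simpa using hasDerivAt_pow 2 x
  -- The derivative of x B(x²) is B(x²) + 2 x² B'(x²), and the first term vanishes at √ρ₂; the
  -- subsonic condition makes the rest positive, so √ρ₂ is a saddle.
  have hder : HasDerivAt (fun x : ℝ => c * (x * bernoulli γ A C (x ^ 2)))
      (c * (2 * ρ₂ * ((γ * ρ₂ ^ (γ + 1) - A ^ 2) / ρ₂ ^ 3))) (√ρ₂) := by
    have hb : HasDerivAt (bernoulli γ A C) ((γ * ρ₂ ^ (γ + 1) - A ^ 2) / ρ₂ ^ 3) (√ρ₂ ^ 2) := by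
      rw [hq2, ← bernoulli_deriv_eq hρ₂]
      exact hasDerivAt_bernoulli hρ₂
    convert! ((hasDerivAt_id (√ρ₂)).mul (hb.comp (h := fun x : ℝ => x ^ 2) (√ρ₂) (hsq _))).const_mul c using 1
    simp only [Function.comp, hq2, h2, id]
    nth_rewrite 1 [← hq2]
    ring
  have hF : ∀ x ∈ Icc (√r) (√ρ₂), HasDerivAt
      (fun x : ℝ => c * (bernoulliPrimitive γ A C (x ^ 2) / 2))
      (c * (x * bernoulli γ A C (x ^ 2))) x := fun x hx => by
    have hx0 : 0 < x := hsubset hx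
    convert! (((hasDerivAt_bernoulliPrimitive (γ := γ) (A := A) (C := C)
      (pow_pos hx0 2)).comp (h := fun x : ℝ => x ^ 2) x (hsq x)).div_const 2).const_mul c using 1
    ring
  obtain ⟨P, Q, hP, hQ, hmem, h⟩ := exists_heteroclinic (p := √ρ₁) ha
    (show 0 < c * (2 * ρ₂ * ((γ * ρ₂ ^ (γ + 1) - A ^ 2) / ρ₂ ^ 3)) by
      have := sub_pos.2 hsub
      positivity) (Real.sqrt_lt_sqrt hr0.le hr) hK (by simp only [hq2, h2, mul_zero]) hder
    (fun x hx h0 => by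
      have hx0 : 0 < x := hm0.trans_le hx.1
      have hb : bernoulli γ A C (x ^ 2) = 0 := by
        simpa [hc.ne', hx0.ne'] using h0
      have hx2 : x ^ 2 < ρ₂ := by
        rw [← hq2]; exact pow_lt_pow_left₀ hx.2 hx0.le two_ne_zero
      rw [← eq_of_bernoulli_eq_zero hγ hρ₁ h1 h2 hsup (pow_pos hx0 2) hx2 hb,
        Real.sqrt_sq hx0.le])
    hF (by
      simp only [hq2, Real.sq_sqrt hr0.le]
      gcongr)
  exact ⟨P, Q, hP, hQ, fun t => hm0.trans (hmem t).1, h⟩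

/-- Bootstrap: the equation expresses Q' by functions as regular as P and Q, positivity of P keeping
B smooth along the orbit. -/
theorem contDiff_of_amplitude_equation {γ A C a c : ℝ} {P Q : ℝ → ℝ} (hpos : ∀ t, 0 < P t)
    (hP : ∀ t, HasDerivAt P (Q t) t)
    (hQ : ∀ t, HasDerivAt Q (c * (P t * bernoulli γ A C (P t ^ 2)) - a * Q t) t) (n : ℕ) :
    ContDiff ℝ n P ∧ ContDiff ℝ n Q := by
  induction n with
  | zero =>
    simp only [Nat.cast_zero, contDiff_zero]
    exact ⟨continuous_iff_continuousAt.2 fun t => (hP t).continuousAt,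
      continuous_iff_continuousAt.2 fun t => (hQ t).continuousAt⟩
  | succ n ih =>
    have hP' : deriv P = Q := funext fun t => (hP t).deriv
    have hQ' : deriv Q = fun t => c * (P t * bernoulli γ A C (P t ^ 2)) - a * Q t :=
      funext fun t => (hQ t).deriv
    push_cast
    rw [contDiff_succ_iff_deriv, contDiff_succ_iff_deriv, hP', hQ']
    refine ⟨⟨fun t => (hP t).differentiableAt, by simp, ih.2⟩,
      fun t => (hQ t).differentiableAt, by simp, ?_⟩
    have hb : ContDiff ℝ n fun t => bernoulli γ A C (P t ^ 2) := by
      rw [← contDiffOn_univ]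
      exact (contDiffOn_bernoulli γ A C n).comp (ih.1.pow 2).contDiffOn
        fun t _ => mem_Ioi.2 (pow_pos (hpos t) 2)
    exact (contDiff_const.mul (ih.1.mul hb)).sub (contDiff_const.mul ih.2)

/-! ### From the amplitude equation to the QHD system -/

theorem hasDerivAt_wave_space {F : ℝ → ℝ} {F' s ε t x : ℝ}
    (h : HasDerivAt F F' ((x - s * t) / ε)) :
    HasDerivAt (fun x' => F ((x' - s * t) / ε)) (F' / ε) x := by
  have h1 : HasDerivAt (fun x' : ℝ => (x' - s * t) / ε) (1 / ε) x :=
    ((hasDerivAt_id x).sub_const (s * t)).div_const ε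
  convert! h.comp x h1 using 1
  ring

theorem hasDerivAt_wave_time {F : ℝ → ℝ} {F' s ε t x : ℝ}
    (h : HasDerivAt F F' ((x - s * t) / ε)) :
    HasDerivAt (fun t' => F ((x - s * t') / ε)) (-s * F' / ε) t := by
  have h1 : HasDerivAt (fun t' : ℝ => (x - s * t') / ε) (-(s * 1) / ε) t :=
    (((hasDerivAt_id t).const_mul s).const_sub x).div_const ε
  convert! h.comp t h1 using 1
  ring

theorem isQHDSolution_of_amplitude {γ μ k A C s ε : ℝ} (hk : k ≠ 0) (hε : 0 < ε)
    {P Q R : ℝ → ℝ} (hpos : ∀ y, 0 < P y) (hP : ∀ y, HasDerivAt P (Q y) y)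
    (hQ : ∀ y, HasDerivAt Q (R y) y) (hsmooth : ContDiff ℝ 3 P)
    (hode : ∀ y, k ^ 2 * R y + 2 * μ * s * Q y = P y * bernoulli γ A C (P y ^ 2)) :
    IsQHDSolution γ μ k ε (fun t x => P ((x - s * t) / ε) ^ 2)
      (fun t x => s - A / P ((x - s * t) / ε) ^ 2) := by
  have hne : ∀ y, P y ≠ 0 := fun y => (hpos y).ne'
  have hwave : ContDiff ℝ 3 fun z : ℝ × ℝ => P ((z.2 - s * z.1) / ε) :=
    hsmooth.comp (by fun_prop)
  have hP2 : ∀ y, HasDerivAt (fun y => P y ^ 2) (2 * P y * Q y) y := fun y => by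
    convert! (hP y).pow 2 using 1
    simp
  have hU : ∀ y, HasDerivAt (fun y => s - A / P y ^ 2) (2 * A * Q y / P y ^ 3) y := fun y => by
    convert! (((hP2 y).inv (pow_ne_zero 2 (hne y))).const_mul A).const_sub s using 1
    have := hne y
    field_simp
  have hPU : ∀ y, HasDerivAt (fun y => P y ^ 2 * (s - A / P y ^ 2)) (2 * s * P y * Q y) y :=
    fun y => by
      have h1 : (fun y => P y ^ 2 * (s - A / P y ^ 2)) = fun y => s * P y ^ 2 - A := by
        funext y
        have := hne y
        field_simp
      rw [h1]
      convert! ((hP2 y).const_mul s).sub_const A using 1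
      ring
  have hU2 : ∀ y, HasDerivAt (fun y => (s - A / P y ^ 2) ^ 2 / 2)
      ((s - A / P y ^ 2) * (2 * A * Q y / P y ^ 3)) y := fun y => by
    convert! ((hU y).pow 2).div_const 2 using 1
    simp only [Nat.cast_ofNat, Nat.add_one_sub_one, pow_one]
    ring
  have hh : ∀ y, HasDerivAt (fun y => enthalpy γ (P y ^ 2))
      (γ * (P y ^ 2) ^ (γ - 2) * (2 * P y * Q y)) y := fun y =>
    (hasDerivAt_enthalpy (pow_pos (hpos y) 2)).comp (h := fun y => P y ^ 2) y (hP2 y)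
  have hb : ∀ y, HasDerivAt (fun y => bernoulli γ A C (P y ^ 2))
      ((γ * (P y ^ 2) ^ (γ - 2) - A ^ 2 / (P y ^ 2) ^ 3) * (2 * P y * Q y)) y := fun y =>
    (hasDerivAt_bernoulli (pow_pos (hpos y) 2)).comp (h := fun y => P y ^ 2) y (hP2 y)
  have hQP : ∀ y, HasDerivAt (fun y => Q y / P y) ((R y * P y - Q y * Q y) / P y ^ 2) y :=
    fun y => (hQ y).div (hP y) (hne y)
  -- R / P is differentiated through the amplitude equation divided by P, so no derivative of R is
  -- needed; this is the velocity equation in differentiated form.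
  have hRP : ∀ y, HasDerivAt (fun y => R y / P y)
      (((γ * (P y ^ 2) ^ (γ - 2) - A ^ 2 / (P y ^ 2) ^ 3) * (2 * P y * Q y)
        - 2 * μ * s * ((R y * P y - Q y * Q y) / P y ^ 2)) / k ^ 2) y := fun y => by
    have h1 : (fun y => R y / P y) =
        fun y => (bernoulli γ A C (P y ^ 2) - 2 * μ * s * (Q y / P y)) / k ^ 2 := by
      funext y
      have := hne y
      have h2 := hode y
      field_simp
      linarith
    rw [h1]
    exact ((hb y).sub ((hQP y).const_mul (2 * μ * s))).div_const (k ^ 2)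
  refine ⟨fun t x => pow_pos (hpos _) 2, hwave.pow 2, ?_, fun t x => ?_, fun t x => ?_⟩
  · exact contDiff_const.sub (contDiff_const.div ((hwave.of_le (by norm_num)).pow 2)
      fun z => pow_ne_zero 2 (hne _))
  · rw [(hasDerivAt_wave_time (hP2 _)).deriv, (hasDerivAt_wave_space (hPU _)).deriv]
    ring
  · have hflux : (fun x' => deriv (fun x'' => P ((x'' - s * t) / ε) ^ 2 *
          (s - A / P ((x'' - s * t) / ε) ^ 2)) x' / P ((x' - s * t) / ε) ^ 2) =
        fun x' => 2 * s / ε * (Q ((x' - s * t) / ε) / P ((x' - s * t) / ε)) := by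
      funext x'
      rw [(hasDerivAt_wave_space (hPU _)).deriv]
      have := hne ((x' - s * t) / ε)
      field_simp
    have hsqrt : (fun x'' => √(P ((x'' - s * t) / ε) ^ 2)) = fun x'' => P ((x'' - s * t) / ε) :=
      funext fun x'' => Real.sqrt_sq (hpos _).le
    have hd2 : ∀ x', iteratedDeriv 2 (fun x'' => P ((x'' - s * t) / ε)) x' =
        R ((x' - s * t) / ε) / ε ^ 2 := fun x' => by
      rw [iteratedDeriv_succ, iteratedDeriv_one]
      have h1 : deriv (fun x'' => P ((x'' - s * t) / ε)) =
          fun x'' => Q ((x'' - s * t) / ε) / ε :=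
        funext fun x'' => (hasDerivAt_wave_space (hP _)).deriv
      rw [h1, ((hasDerivAt_wave_space (hQ _)).div_const ε).deriv]
      field_simp
    have hquantum : (fun x' => iteratedDeriv 2 (fun x'' => √(P ((x'' - s * t) / ε) ^ 2)) x' /
          √(P ((x' - s * t) / ε) ^ 2)) =
        fun x' => 1 / ε ^ 2 * (R ((x' - s * t) / ε) / P ((x' - s * t) / ε)) := by
      funext x'
      rw [hsqrt, hd2, Real.sqrt_sq (hpos _).le]
      have := hne ((x' - s * t) / ε)
      field_simp
    rw [hflux, hquantum, (hasDerivAt_wave_time (hU _)).deriv,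
      (hasDerivAt_wave_space (hU2 _)).deriv, (hasDerivAt_wave_space (hh _)).deriv,
      ((hasDerivAt_wave_space (hQP _)).const_mul _).deriv,
      ((hasDerivAt_wave_space (hRP _)).const_mul _).deriv]
    have := hne ((x - s * t) / ε)
    field_simp
    ring

theorem isTravelingWaveProfile_of_amplitude {γ μ k ρm um ρp up A C s : ℝ} (hk : k ≠ 0)
    (hρm : 0 < ρm) (hρp : 0 < ρp) (hAm : A = (s - um) * ρm) (hAp : A = (s - up) * ρp)
    {P Q R : ℝ → ℝ} (hpos : ∀ y, 0 < P y) (hP : ∀ y, HasDerivAt P (Q y) y)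
    (hQ : ∀ y, HasDerivAt Q (R y) y) (hsmooth : ContDiff ℝ 3 P)
    (hode : ∀ y, k ^ 2 * R y + 2 * μ * s * Q y = P y * bernoulli γ A C (P y ^ 2))
    (hPbot : Tendsto P atBot (𝓝 (√ρm))) (hPtop : Tendsto P atTop (𝓝 (√ρp)))
    (hQbot : Tendsto Q atBot (𝓝 0)) (hQtop : Tendsto Q atTop (𝓝 0)) :
    IsTravelingWaveProfile γ μ k ρm um ρp up s P fun y => s - A / P y ^ 2 := by
  have hP' : deriv P = Q := funext fun y => (hP y).deriv
  have hlim : ∀ {l : Filter ℝ} {ρ u : ℝ}, 0 < ρ → A = (s - u) * ρ → Tendsto P l (𝓝 (√ρ)) →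
      Tendsto (fun y => s - A / P y ^ 2) l (𝓝 u) := fun {l ρ u} hρ hA h => by
    have h1 := (tendsto_const_nhds (x := A)).div (h.pow 2)
      (pow_ne_zero 2 (Real.sqrt_pos.2 hρ).ne')
    have h2 := h1.const_sub s
    rwa [Real.sq_sqrt hρ.le, hA, mul_div_cancel_right₀ _ hρ.ne', sub_sub_cancel, ← hA] at h2
  exact ⟨hpos, fun ε hε => isQHDSolution_of_amplitude hk hε hpos hP hQ hsmooth hode, hPbot, hPtop,
    hP' ▸ hQbot, hP' ▸ hQtop, hlim hρm hAm hPbot, hlim hρp hAp hPtop⟩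

/-! ### Lax shocks -/

theorem rpow_add_one_eq_mul_sq {γ ρ : ℝ} (hρ : 0 < ρ) : ρ ^ (γ + 1) = ρ ^ (γ - 1) * ρ ^ 2 := by
  rw [← Real.rpow_natCast, ← Real.rpow_add hρ]
  congr 1
  push_cast
  ring

theorem sq_flux_lt_of_abs_lt_soundSpeed {γ A ρ v : ℝ} (hρ : 0 < ρ) (hA : A = v * ρ)
    (h : |v| < soundSpeed γ ρ) : A ^ 2 < γ * ρ ^ (γ + 1) := by
  rw [soundSpeed_eq hρ, Real.lt_sqrt (abs_nonneg _), sq_abs] at h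
  rw [rpow_add_one_eq_mul_sq hρ, hA, mul_pow, ← mul_assoc]
  gcongr

theorem lt_sq_flux_of_soundSpeed_lt_abs {γ A ρ v : ℝ} (hγ : 0 ≤ γ) (hρ : 0 < ρ)
    (hA : A = v * ρ) (h : soundSpeed γ ρ < |v|) : γ * ρ ^ (γ + 1) < A ^ 2 := by
  rw [soundSpeed_eq hρ, Real.sqrt_lt (by positivity) (abs_nonneg _), sq_abs] at h
  rw [rpow_add_one_eq_mul_sq hρ, hA, mul_pow, ← mul_assoc]
  gcongr

theorem exists_profile_of_laxTwoShock {γ μ k ρm um ρp up s : ℝ} (hγ : 1 ≤ γ) (hμ : 0 < μ)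
    (hk : 0 < k) (hρm : 0 < ρm) (hρp : 0 < ρp) {A C : ℝ}
    (hAm : A = (s - um) * ρm) (hAp : A = (s - up) * ρp)
    (hCm : bernoulli γ A C ρm = 0) (hCp : bernoulli γ A C ρp = 0)
    (hright : lambda₂ γ ρp up < s) (hleft : s < lambda₂ γ ρm um) (hsub : IsSubsonic γ ρp up) :
    ∃ P U : ℝ → ℝ, IsTravelingWaveProfile γ μ k ρm um ρp up s P U := by
  have hcp : 0 ≤ soundSpeed γ ρp := Real.sqrt_nonneg _
  simp only [lambda₂] at hright hleft
  -- The subsonic hypothesis serves only here, to give the friction 2 μ s / k² its sign.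
  have hs : 0 < s := by linarith [(abs_lt.1 hsub).1]
  have hA : 0 < A := by rw [hAp]; exact mul_pos (by linarith) hρp
  have hvm : 0 < s - um := pos_of_mul_pos_left (hAm ▸ hA) hρm.le
  obtain ⟨P, Q, hP, hQ, hpos, hPbot, hPtop, hQbot, hQtop⟩ :=
    exists_amplitude_orbit (A := A) (C := C) (a := 2 * μ * s / k ^ 2) (c := 1 / k ^ 2) hγ
      (by positivity) (by positivity) hρp hρm hCp hCm
      (lt_sq_flux_of_soundSpeed_lt_abs (by linarith) hρp hAp
        (by rw [abs_of_pos (by linarith)]; linarith))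
      (sq_flux_lt_of_abs_lt_soundSpeed hρm hAm (by rw [abs_of_pos hvm]; linarith))
  refine ⟨P, _, isTravelingWaveProfile_of_amplitude (A := A) (C := C) hk.ne' hρm hρp
    hAm hAp hpos hP hQ (contDiff_of_amplitude_equation hpos hP hQ 3).1 (fun y => ?_) hPbot hPtop hQbot hQtop⟩
  field_simp
  ring

/-- Here s < 0 and the left state is the supersonic one relative to the shock. The reflection y ↦ -y
turns the friction into -s > 0 and exchanges the ends, so the orbit is built from the right state to
the left one and then reversed. -/
theorem exists_profile_of_laxOneShock {γ μ k ρm um ρp up s : ℝ} (hγ : 1 ≤ γ) (hμ : 0 < μ)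
    (hk : 0 < k) (hρm : 0 < ρm) (hρp : 0 < ρp) {A C : ℝ}
    (hAm : A = (s - um) * ρm) (hAp : A = (s - up) * ρp)
    (hCm : bernoulli γ A C ρm = 0) (hCp : bernoulli γ A C ρp = 0)
    (hright : lambda₁ γ ρp up < s) (hleft : s < lambda₁ γ ρm um) (hsub : IsSubsonic γ ρm um) :
    ∃ P U : ℝ → ℝ, IsTravelingWaveProfile γ μ k ρm um ρp up s P U := by
  have hcm : 0 ≤ soundSpeed γ ρm := Real.sqrt_nonneg _
  simp only [lambda₁] at hright hleft
  have hs : 0 < -s := by linarith [(abs_lt.1 hsub).2]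
  have hA : 0 < -A := by rw [hAm, ← neg_mul]; exact mul_pos (by linarith) hρm
  have hvp : 0 < -(s - up) := by
    rw [hAp, ← neg_mul] at hA
    exact pos_of_mul_pos_left hA hρp.le
  obtain ⟨P, Q, hP, hQ, hpos, hPbot, hPtop, hQbot, hQtop⟩ :=
    exists_amplitude_orbit (A := A) (C := C) (a := 2 * μ * (-s) / k ^ 2) (c := 1 / k ^ 2) hγ
      (by positivity) (by positivity) hρm hρp hCm hCp
      (lt_sq_flux_of_soundSpeed_lt_abs (by linarith) hρm hAm
        (by rw [abs_of_neg (by linarith)]; linarith))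
      (sq_flux_lt_of_abs_lt_soundSpeed hρp hAp
        (by rw [abs_of_neg (by linarith)]; linarith))
  have hrev : ∀ {F F' : ℝ → ℝ}, (∀ y, HasDerivAt F (F' y) y) →
      ∀ y, HasDerivAt (fun y => F (-y)) (-F' (-y)) y := fun {F F'} hF y => by
    have h2 := (hF (-y)).scomp y (hasDerivAt_neg y)
    simpa [Function.comp_def] using h2
  refine ⟨fun y => P (-y), _, isTravelingWaveProfile_of_amplitude (A := A) (C := C) hk.ne' hρm hρp
    hAm hAp (fun y => hpos (-y)) (hrev hP) (fun y => (hrev hQ y).neg)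
    ((contDiff_of_amplitude_equation hpos hP hQ 3).1.comp contDiff_neg) (fun y => ?_)
    (hPtop.comp tendsto_neg_atBot_atTop) (hPbot.comp tendsto_neg_atTop_atBot)
    (by simpa using (hQtop.comp tendsto_neg_atBot_atTop).neg)
    (by simpa using (hQbot.comp tendsto_neg_atTop_atBot).neg)⟩
  field_simp
  ring

end QHD

end

theorem corollary3p2 (γ μ k : ℝ) (hγ : 1 ≤ γ) (hμ : 0 < μ) (hk : 0 < k)
    (ρm um ρp up s : ℝ) (hρm : 0 < ρm) (hρp : 0 < ρp)
    (hshock :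
      (QHD.IsLaxTwoShock γ ρm um ρp up s ∧ QHD.IsSubsonic γ ρp up) ∨
      (QHD.IsLaxOneShock γ ρm um ρp up s ∧ QHD.IsSubsonic γ ρm um)) :
    ∃ P U : ℝ → ℝ, QHD.IsTravelingWaveProfile γ μ k ρm um ρp up s P U := by
  have hRH : QHD.RankineHugoniot γ ρm um ρp up s := by
    rcases hshock with h | h
    · exact h.1.rankineHugoniot
    · exact h.1.rankineHugoniot
  have hA : (s - um) * ρm = (s - up) * ρp := by linarith [hRH.mass]
  have hquot : ∀ {v ρ : ℝ}, 0 < ρ → (v * ρ) ^ 2 / (2 * ρ ^ 2) = v ^ 2 / 2 := fun {v ρ} hρ => by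
    field_simp
  -- C is the Bernoulli constant (s - u)² / 2 + h(ρ) of the left state; the second Rankine–Hugoniot
  -- condition says that the right state has the same one.
  have hCm : QHD.bernoulli γ ((s - um) * ρm) ((s - um) ^ 2 / 2 + QHD.enthalpy γ ρm) ρm = 0 := by
    rw [QHD.bernoulli, hquot hρm, sub_self]
  have hCp : QHD.bernoulli γ ((s - um) * ρm) ((s - um) ^ 2 / 2 + QHD.enthalpy γ ρm) ρp = 0 := by
    rw [QHD.bernoulli, hA, hquot hρp]
    linarith [hRH.velocity]
  rcases hshock with ⟨h, hsub⟩ | ⟨h, hsub⟩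
  · exact QHD.exists_profile_of_laxTwoShock hγ hμ hk hρm hρp rfl hA hCm hCp h.right_lt h.lt_left
      hsub
  · exact QHD.exists_profile_of_laxOneShock hγ hμ hk hρm hρp rfl hA hCm hCp h.right_lt h.lt_left
      hsub
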